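/- Let $q$ be a complex number with $0<|q|<1$. Write $(x;q)_\infty=\prod_{i=0}^{\infty}(1-xq^i)$, $(x;q)_n=\prod_{i=0}^{n-1}(1-xq^i)$ for integers $n\ge 0$, and $(a,b,c;q)_\infty=(a;q)_\infty(b;q)_\infty(c;q)_\infty$. Then the series below converges absolutely, and $$(q;q)_\infty\sum_{n=1}^{\infty}\frac{q^{2n^2-n}}{(1+q^n)\,(q;q)_{2n-1}} =(-q^{10},-q^{14},q^{24};q^{24})_\infty-(-q^{11},-q^{13},q^{24};q^{24})_\infty +q\,(-q^{5},-q^{19},q^{24};q^{24})_\infty-q^{2}\,(-q^{2},-q^{22},q^{24};q^{24})_\infty .$$ -/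

import Mathlib

/-- The infinite `q`-shifted factorial `(x; q)_∞ = ∏_{i ≥ 0} (1 - x q^i)`
(the product converges for `|q| < 1`, see `multipliable_qPochInf`). -/
noncomputable def qPochInf (x q : ℂ) : ℂ := ∏' i : ℕ, (1 - x * q ^ i)

/-- The finite `q`-shifted factorial `(x; q)_n = ∏_{0 ≤ i < n} (1 - x q^i)`; it is
the quotient `(x; q)_∞ / (x q^n; q)_∞`, see `qPoch_eq_div`. -/
noncomputable def qPoch (x q : ℂ) (n : ℕ) : ℂ := ∏ i ∈ Finset.range n, (1 - x * q ^ i)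

/-- The compact notation `(a, b, c; q)_∞ = (a; q)_∞ (b; q)_∞ (c; q)_∞`. -/
noncomputable def qPochInf₃ (a b c q : ℂ) : ℂ := qPochInf a q * qPochInf b q * qPochInf c q

theorem multipliable_qPochInf (x : ℂ) {q : ℂ} (hq : ‖q‖ < 1) :
    Multipliable fun i : ℕ => 1 - x * q ^ i := by
  have h : Summable fun i : ℕ => ‖-(x * q ^ i)‖ := by
    simpa [norm_mul, norm_pow] using
      (summable_geometric_of_lt_one (norm_nonneg q) hq).mul_left ‖x‖
  simpa [sub_eq_add_neg] using multipliable_one_add_of_summable h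

theorem qPoch_eq_div (x : ℂ) {q : ℂ} (hq : ‖q‖ < 1) (n : ℕ)
    (h : qPochInf (x * q ^ n) q ≠ 0) :
    qPoch x q n = qPochInf x q / qPochInf (x * q ^ n) q := by
  rw [eq_div_iff h]
  have hm : Multipliable fun i : ℕ => 1 - x * q ^ (i + n) := by
    simpa [pow_add, mul_assoc, mul_comm, mul_left_comm] using
      multipliable_qPochInf (x * q ^ n) hq
  have := Multipliable.prod_mul_tprod_nat_mul' (f := fun i : ℕ => 1 - x * q ^ i) hm
  simpa [qPoch, qPochInf, pow_add, mul_assoc, mul_comm, mul_left_comm] using this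

open Filter Topology

/-! Since $(q;q)_{2n}=(q;q)_{2n-1}(1-q^n)(1+q^n)$, the summand is
$(q^{2n^2-n}-q^{2n^2})/(q;q)_{2n}$. Both pieces are even-degree parts of Euler's expansion
(`hasSum_euler`), at $x=1$ and at $x=p$ with $p^2=q$, so the sum is
$(-q;q)_\infty-\frac12((-p;q)_\infty+(p;q)_\infty)$ (`hasSum_evenDegree_sub`). Multiplying by
$(q;q)_\infty$ gives $(q^2;q^2)_\infty-\frac12((p;p)_\infty+(-p;-p)_\infty)$. The pentagonal number
theorem expands each product, and splitting the index by residue class leaves two theta series from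
each (`qPochInf_sq`, `qPochInf_add_qPochInf_neg`), which the Jacobi triple product turns back into
products. -/

theorem qPoch_succ (x q : ℂ) (n : ℕ) : qPoch x q (n + 1) = qPoch x q n * (1 - x * q ^ n) :=
  Finset.prod_range_succ _ _

@[simp] theorem qPoch_zero (x q : ℂ) : qPoch x q 0 = 1 := Finset.prod_range_zero _

theorem tendsto_qPoch (x : ℂ) {q : ℂ} (hq : ‖q‖ < 1) :
    Tendsto (qPoch x q) atTop (𝓝 (qPochInf x q)) :=
  (multipliable_qPochInf x hq).hasProd.tendsto_prod_nat

theorem one_sub_mul_pow_ne_zero {q : ℂ} (hq : ‖q‖ < 1) (i : ℕ) : 1 - q * q ^ i ≠ 0 := by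
  intro h
  have h1 : ‖q ^ (i + 1)‖ = 1 := by
    rw [pow_succ', ← sub_eq_zero.mp h, norm_one]
  rw [norm_pow] at h1
  exact (pow_lt_one₀ (norm_nonneg q) hq i.succ_ne_zero).ne h1

theorem qPoch_self_ne_zero {q : ℂ} (hq : ‖q‖ < 1) (n : ℕ) : qPoch q q n ≠ 0 :=
  Finset.prod_ne_zero_iff.mpr fun i _ => one_sub_mul_pow_ne_zero hq i

theorem qPochInf_self_ne_zero {q : ℂ} (hq : ‖q‖ < 1) : qPochInf q q ≠ 0 := by
  have h : Summable fun i : ℕ => ‖-(q * q ^ i)‖ := by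
    simpa [norm_mul, norm_pow] using
      (summable_geometric_of_lt_one (norm_nonneg q) hq).mul_left ‖q‖
  simpa [qPochInf, sub_eq_add_neg] using tprod_one_add_ne_zero_of_summable
    (fun i => by simpa [sub_eq_add_neg] using one_sub_mul_pow_ne_zero hq i) h

/-! ### Gaussian binomials and the q-binomial theorem -/

/-- The Gaussian binomial coefficient, as a quotient of `q`-shifted factorials. -/
noncomputable def gaussBinom (q : ℂ) (n k : ℕ) : ℂ :=
  if k ≤ n then qPoch q q n / (qPoch q q k * qPoch q q (n - k)) else 0

theorem gaussBinom_of_lt (q : ℂ) {n k : ℕ} (h : n < k) : gaussBinom q n k = 0 :=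
  if_neg h.not_ge

theorem gaussBinom_add (q : ℂ) (k m : ℕ) :
    gaussBinom q (k + m) k = qPoch q q (k + m) / (qPoch q q k * qPoch q q m) := by
  simp [gaussBinom]

theorem gaussBinom_zero_right {q : ℂ} (hq : ‖q‖ < 1) (n : ℕ) : gaussBinom q n 0 = 1 := by
  simp [gaussBinom, qPoch_self_ne_zero hq]

/-- The q-Pascal rule; writing the upper index as `k + m` avoids truncated subtraction in the
exponent. -/
theorem gaussBinom_succ_succ {q : ℂ} (hq : ‖q‖ < 1) (k m : ℕ) :
    gaussBinom q (k + m + 1) (k + 1) =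
      gaussBinom q (k + m) (k + 1) + q ^ m * gaussBinom q (k + m) k := by
  have h := qPoch_self_ne_zero hq
  rcases m with _ | m
  · simp [gaussBinom, h]
  · have e1 := gaussBinom_add q (k + 1) (m + 1)
    have e2 := gaussBinom_add q (k + 1) m
    rw [show k + 1 + (m + 1) = k + (m + 1) + 1 by ring] at e1
    rw [show k + 1 + m = k + (m + 1) by ring] at e2
    rw [e1, e2, gaussBinom_add, qPoch_succ _ _ (k + (m + 1)), qPoch_succ _ _ k,
      qPoch_succ _ _ m]
    have h1 := h (k + (m + 1))
    have h2 := h k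
    have h3 := h m
    have h4 := one_sub_mul_pow_ne_zero hq k
    have h5 := one_sub_mul_pow_ne_zero hq m
    field_simp
    ring

/-- The `q`-binomial theorem. -/
theorem prod_one_add_mul_pow {q : ℂ} (hq : ‖q‖ < 1) (x : ℂ) (n : ℕ) :
    qPoch (-x) q n =
      ∑ k ∈ Finset.range (n + 1), q ^ k.choose 2 * gaussBinom q n k * x ^ k := by
  induction n with
  | zero => simp [gaussBinom]
  | succ n ih =>
    have key : ∀ k ∈ Finset.range (n + 1),
        q ^ (k + 1).choose 2 * gaussBinom q (n + 1) (k + 1) * x ^ (k + 1) =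
          q ^ (k + 1).choose 2 * gaussBinom q n (k + 1) * x ^ (k + 1) +
            x * q ^ n * (q ^ k.choose 2 * gaussBinom q n k * x ^ k) := by
      intro k hk
      obtain ⟨m, rfl⟩ := Nat.exists_eq_add_of_le (Nat.lt_succ_iff.mp (Finset.mem_range.mp hk))
      rw [gaussBinom_succ_succ hq, Nat.choose_succ_succ' k 1, Nat.choose_one_right]
      ring
    rw [Finset.sum_range_succ', Finset.sum_congr rfl key, Finset.sum_add_distrib,
      ← Finset.mul_sum, ← ih, qPoch_succ, Finset.sum_range_succ,
      gaussBinom_of_lt q (Nat.lt_succ_self n)]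
    have h0 := ih
    rw [Finset.sum_range_succ'] at h0
    simp only [gaussBinom_zero_right hq] at h0 ⊢
    linear_combination h0

/-! ### Euler's expansion, by dominated convergence -/

/-- $(q;q)_n$ has a nonzero limit, so it and its inverse are bounded. The uniform bound gives the
dominating series for both Euler's expansion and the triple product. -/
theorem exists_norm_gaussBinom_le {q : ℂ} (hq : ‖q‖ < 1) :
    ∃ M : ℝ, ∀ n k, ‖gaussBinom q n k‖ ≤ M := by
  obtain ⟨A, hA⟩ := (tendsto_qPoch q hq).norm.bddAbove_range
  obtain ⟨B, hB⟩ := ((tendsto_qPoch q hq).inv₀ (qPochInf_self_ne_zero hq)).norm.bddAbove_range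
  have hA' : ∀ n, ‖qPoch q q n‖ ≤ A := fun n => hA ⟨n, rfl⟩
  have hB' : ∀ n, ‖(qPoch q q n)⁻¹‖ ≤ B := fun n => hB ⟨n, rfl⟩
  have hA0 : 0 ≤ A := (norm_nonneg _).trans (hA' 0)
  have hB0 : 0 ≤ B := (norm_nonneg _).trans (hB' 0)
  refine ⟨A * (B * B), fun n k => ?_⟩
  unfold gaussBinom
  split_ifs
  · rw [div_eq_mul_inv, mul_inv, norm_mul, norm_mul]
    gcongr
    exacts [hA' _, hB' _, hB' _]
  · rw [norm_zero]; positivity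

theorem summable_pow_choose_two_mul_pow {q : ℂ} (hq : ‖q‖ < 1) (x : ℂ) :
    Summable fun k : ℕ => ‖q ^ k.choose 2 * x ^ k‖ := by
  have ht : Tendsto (fun k : ℕ => ‖q‖ ^ k * ‖x‖) atTop (𝓝 0) := by
    simpa using (tendsto_pow_atTop_nhds_zero_of_lt_one (norm_nonneg q) hq).mul_const ‖x‖
  refine summable_of_ratio_norm_eventually_le (r := 1 / 2) (by norm_num) ?_
  filter_upwards [ht.eventually (ge_mem_nhds (by norm_num : (0 : ℝ) < 1 / 2))] with k hk
  rw [norm_norm, norm_norm, Nat.choose_succ_succ' k 1, Nat.choose_one_right, pow_add, pow_succ,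
    show q ^ k * q ^ k.choose 2 * (x ^ k * x) = q ^ k * x * (q ^ k.choose 2 * x ^ k) by ring,
    norm_mul, norm_mul (q ^ k), norm_pow q k]
  gcongr

theorem tendsto_gaussBinom {q : ℂ} (hq : ‖q‖ < 1) (k : ℕ) :
    Tendsto (fun n => gaussBinom q n k) atTop (𝓝 (qPoch q q k)⁻¹) := by
  rw [← tendsto_add_atTop_iff_nat k]
  have h := tendsto_qPoch q hq
  have := ((tendsto_add_atTop_iff_nat k).mpr h).div
    (h.const_mul (qPoch q q k)) (mul_ne_zero (qPoch_self_ne_zero hq k) (qPochInf_self_ne_zero hq))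
  convert this using 2 with n
  · simp [gaussBinom]
  · have := qPochInf_self_ne_zero hq
    have := qPoch_self_ne_zero hq k
    field_simp

/-- Euler's expansion of `(-x; q)_∞`. -/
theorem hasSum_euler {q : ℂ} (hq : ‖q‖ < 1) (x : ℂ) :
    HasSum (fun k : ℕ => q ^ k.choose 2 / qPoch q q k * x ^ k) (qPochInf (-x) q) := by
  obtain ⟨M, hM⟩ := exists_norm_gaussBinom_le hq
  have hb : ∀ n k, ‖q ^ k.choose 2 * gaussBinom q n k * x ^ k‖ ≤ M * ‖q ^ k.choose 2 * x ^ k‖ := by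
    intro n k
    rw [mul_right_comm, norm_mul, mul_comm]
    exact mul_le_mul_of_nonneg_right (hM n k) (norm_nonneg _)
  have hlim : ∀ k, Tendsto (fun n => q ^ k.choose 2 * gaussBinom q n k * x ^ k) atTop
      (𝓝 (q ^ k.choose 2 / qPoch q q k * x ^ k)) := fun k =>
    ((tendsto_gaussBinom hq k).const_mul _).mul_const _
  have hs := (summable_pow_choose_two_mul_pow hq x).mul_left M
  have h := tendsto_tsum_of_dominated_convergence hs hlim (Eventually.of_forall hb)
  have hsum : Summable fun k : ℕ => q ^ k.choose 2 / qPoch q q k * x ^ k :=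
    .of_norm_bounded hs fun k =>
      le_of_tendsto (hlim k).norm (Eventually.of_forall fun n => hb n k)
  have he : ∀ n, ∑' k, q ^ k.choose 2 * gaussBinom q n k * x ^ k = qPoch (-x) q n := by
    intro n
    rw [prod_one_add_mul_pow hq, tsum_eq_sum]
    intro k hk
    rw [gaussBinom_of_lt q (by simpa using hk)]
    ring
  simp only [he] at h
  rw [← tendsto_nhds_unique h (tendsto_qPoch (-x) hq)]
  exact hsum.hasSum

/-! ### The Jacobi triple product -/

theorem qPoch_succ' (x q : ℂ) (n : ℕ) : qPoch x q (n + 1) = (1 - x) * qPoch (x * q) q n := by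
  simp only [qPoch, Finset.prod_range_succ', pow_zero, mul_one, mul_comm (1 - x)]
  congr 1
  exact Finset.prod_congr rfl fun i _ => by ring

theorem qPoch_add (x q : ℂ) (m n : ℕ) :
    qPoch x q (m + n) = qPoch x q m * qPoch (x * q ^ m) q n := by
  simp only [qPoch, Finset.prod_range_add]
  congr 1
  exact Finset.prod_congr rfl fun i _ => by ring

/-- Reversal of the product, factor by factor: $1+xq^{-j}=xq^{-j}(1+q^j/x)$ for $1\le j\le n$. -/
theorem qPoch_neg_div_pow {q x : ℂ} (hq : q ≠ 0) (hx : x ≠ 0) (n : ℕ) :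
    qPoch (-(x / q ^ n)) q n = x ^ n / q ^ (n + 1).choose 2 * qPoch (-(q / x)) q n := by
  induction n with
  | zero => simp
  | succ n ih =>
    rw [qPoch_succ', show -(x / q ^ (n + 1)) * q = -(x / q ^ n) by rw [pow_succ]; field_simp, ih, qPoch_succ,
      Nat.choose_succ_succ' (n + 1) 1, Nat.choose_one_right]
    field_simp
    ring

theorem two_mul_triangle (k : ℤ) : 2 * (k * (k - 1) / 2) = k * (k - 1) :=
  Int.mul_ediv_cancel' (Int.even_mul_pred_self k).two_dvd

theorem two_mul_choose_two (n : ℕ) : 2 * (n.choose 2 : ℤ) = n * (n - 1) := by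
  induction n with
  | zero => simp
  | succ n ih =>
    rw [Nat.choose_succ_succ' n 1, Nat.choose_one_right]
    push_cast
    linarith

/-- The finite form of the Jacobi triple product. -/
theorem qPoch_mul_qPoch_neg_div {q x : ℂ} (hq0 : q ≠ 0) (hq : ‖q‖ < 1) (hx : x ≠ 0) (n : ℕ) :
    qPoch (-x) q n * qPoch (-(q / x)) q n = ∑ j ∈ Finset.range (2 * n + 1),
      gaussBinom q (2 * n) j *
        (q ^ (((j : ℤ) - n) * ((j : ℤ) - n - 1) / 2) * x ^ ((j : ℤ) - n)) := by
  -- The shift by $q^{-n}$ centres the $2n$ factors, so that half of them reverse into powers of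
  -- $q/x$.
  have h := prod_one_add_mul_pow hq (x / q ^ n) (2 * n)
  rw [two_mul, qPoch_add, qPoch_neg_div_pow hq0 hx, ← two_mul,
    show -(x / q ^ n) * q ^ n = -x by field_simp] at h
  have h' : qPoch (-x) q n * qPoch (-(q / x)) q n = q ^ (n + 1).choose 2 / x ^ n *
      (x ^ n / q ^ (n + 1).choose 2 * qPoch (-(q / x)) q n * qPoch (-x) q n) := by
    field_simp
  rw [h', h, Finset.mul_sum]
  refine Finset.sum_congr rfl fun j _ => ?_
  have e : ((j : ℤ) - n) * ((j : ℤ) - n - 1) / 2 = (n + 1).choose 2 + j.choose 2 - n * j := by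
    have h1 := two_mul_triangle ((j : ℤ) - n)
    have h2 := two_mul_choose_two (n + 1)
    have h3 := two_mul_choose_two j
    push_cast at h2
    linarith
  rw [e, zpow_sub₀ hq0, zpow_add₀ hq0, zpow_sub₀ hx, div_pow, ← pow_mul]
  simp only [zpow_natCast, ← Nat.cast_mul]
  field_simp

theorem summable_triple {q x : ℂ} (hq0 : q ≠ 0) (hq : ‖q‖ < 1) (hx : x ≠ 0) :
    Summable fun k : ℤ => ‖q ^ (k * (k - 1) / 2) * x ^ k‖ := by
  refine .of_nat_of_neg ?_ ?_
  · refine (summable_pow_choose_two_mul_pow hq x).congr fun k => ?_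
    rw [show (k : ℤ) * ((k : ℤ) - 1) / 2 = (k.choose 2 : ℕ) by
      linarith [two_mul_triangle k, two_mul_choose_two k], zpow_natCast, zpow_natCast]
  · refine (summable_pow_choose_two_mul_pow hq (q / x)).congr fun k => ?_
    rw [show (-(k : ℤ)) * (-(k : ℤ) - 1) / 2 = (k.choose 2 + k : ℕ) by
      push_cast
      linarith [two_mul_triangle (-k), two_mul_choose_two k], zpow_natCast, zpow_neg,
      zpow_natCast, pow_add, div_pow]
    field_simp

theorem tendsto_gaussBinom_central {q : ℂ} (hq : ‖q‖ < 1) (k : ℤ) :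
    Tendsto (fun n : ℕ => gaussBinom q (2 * n) (n + k).toNat) atTop (𝓝 (qPochInf q q)⁻¹) := by
  have h := tendsto_qPoch q hq
  have h0 := qPochInf_self_ne_zero hq
  have h1 : Tendsto (fun n : ℕ => ((n : ℤ) + k).toNat) atTop atTop :=
    tendsto_atTop.mpr fun b => by
      filter_upwards [eventually_ge_atTop (b + k.natAbs)] with n hn
      omega
  have h2 : Tendsto (fun n : ℕ => 2 * n - ((n : ℤ) + k).toNat) atTop atTop :=
    tendsto_atTop.mpr fun b => by
      filter_upwards [eventually_ge_atTop (b + k.natAbs)] with n hn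
      omega
  have h3 : Tendsto (fun n : ℕ => 2 * n) atTop atTop :=
    tendsto_atTop.mpr fun b => by
      filter_upwards [eventually_ge_atTop b] with n hn
      omega
  have := (h.comp h3).div ((h.comp h1).mul (h.comp h2)) (mul_ne_zero h0 h0)
  rw [show qPochInf q q / (qPochInf q q * qPochInf q q) = (qPochInf q q)⁻¹ by field_simp] at this
  refine this.congr' ?_
  filter_upwards [eventually_ge_atTop k.natAbs] with n hn
  rw [gaussBinom, if_pos (by omega)]
  rfl

/-- The Jacobi triple product identity. -/
theorem hasSum_triple {q x : ℂ} (hq0 : q ≠ 0) (hq : ‖q‖ < 1) (hx : x ≠ 0) :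
    HasSum (fun k : ℤ => q ^ (k * (k - 1) / 2) * x ^ k) (qPochInf₃ (-x) (-(q / x)) q q) := by
  obtain ⟨M, hM⟩ := exists_norm_gaussBinom_le hq
  have hM0 : 0 ≤ M := (norm_nonneg _).trans (hM 0 0)
  have hsum := summable_triple hq0 hq hx
  -- The guard is needed only below $-n$, where `toNat` would clip to 0; above $n$ the Gaussian
  -- binomial already vanishes.
  let f : ℕ → ℤ → ℂ := fun n k => if -(n : ℤ) ≤ k then
    gaussBinom q (2 * n) (n + k).toNat * (q ^ (k * (k - 1) / 2) * x ^ k) else 0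
  have hb : ∀ n k, ‖f n k‖ ≤ M * ‖q ^ (k * (k - 1) / 2) * x ^ k‖ := by
    intro n k
    simp only [f]
    split_ifs
    · rw [norm_mul]
      exact mul_le_mul_of_nonneg_right (hM _ _) (norm_nonneg _)
    · rw [norm_zero]; positivity
  have hlim : ∀ k, Tendsto (f · k) atTop
      (𝓝 ((qPochInf q q)⁻¹ * (q ^ (k * (k - 1) / 2) * x ^ k))) := by
    intro k
    refine ((tendsto_gaussBinom_central hq k).mul_const _).congr' ?_
    filter_upwards [eventually_ge_atTop k.natAbs] with n hn
    simp only [f]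
    rw [if_pos (by omega)]
  have h := tendsto_tsum_of_dominated_convergence (hsum.mul_left M) hlim
    (Eventually.of_forall hb)
  have hf : ∀ n, ∑' k, f n k = qPoch (-x) q n * qPoch (-(q / x)) q n := by
    intro n
    have hinj : Function.Injective fun j : ℕ => (j : ℤ) - n := fun a b hab => by
      simpa using hab
    rw [qPoch_mul_qPoch_neg_div hq0 hq hx, ← hinj.tsum_eq, tsum_eq_sum]
    · refine Finset.sum_congr rfl fun j _ => ?_
      simp [f]
    · intro j hj
      simp only [f, Finset.mem_range, not_lt] at hj ⊢
      rw [if_pos (by omega), gaussBinom_of_lt q (by omega), zero_mul]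
    · intro k hk
      by_contra hk'
      refine hk (if_neg fun hle => hk' ⟨(n + k).toNat, ?_⟩)
      simp only
      omega
  simp only [hf] at h
  have h' := tendsto_nhds_unique h ((tendsto_qPoch (-x) hq).mul (tendsto_qPoch (-(q / x)) hq))
  rw [tsum_mul_left, inv_mul_eq_iff_eq_mul₀ (qPochInf_self_ne_zero hq)] at h'
  rw [qPochInf₃, mul_comm, ← h']
  exact hsum.of_norm.hasSum

/-! ### The pentagonal number theorem and theta series -/

/-- Splitting `(x; q)_∞` along residue classes of the exponent. -/
theorem prod_qPochInf_mul_pow (x : ℂ) {q : ℂ} (hq : ‖q‖ < 1) {m : ℕ} (hm : m ≠ 0) :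
    ∏ j ∈ Finset.range m, qPochInf (x * q ^ j) (q ^ m) = qPochInf x q := by
  have hqm : ‖q ^ m‖ < 1 := by
    rw [norm_pow]
    exact pow_lt_one₀ (norm_nonneg q) hq hm
  have h1 : Tendsto (fun n => ∏ j ∈ Finset.range m, qPoch (x * q ^ j) (q ^ m) n) atTop
      (𝓝 (∏ j ∈ Finset.range m, qPochInf (x * q ^ j) (q ^ m))) :=
    tendsto_finsetProd _ fun j _ => tendsto_qPoch _ hqm
  have h2 : Tendsto (fun n => qPoch x q (m * n)) atTop (𝓝 (qPochInf x q)) :=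
    (tendsto_qPoch x hq).comp (tendsto_id.const_mul_atTop' hm.bot_lt)
  refine tendsto_nhds_unique h1 (h2.congr fun n => ?_)
  induction n with
  | zero => simp
  | succ n ih =>
    rw [mul_add_one, qPoch_add, ih]
    simp only [qPoch_succ, Finset.prod_mul_distrib]
    congr 1
    exact Finset.prod_congr rfl fun j _ => by ring

/-- Euler's pentagonal number theorem. -/
theorem hasSum_pentagonal {r : ℂ} (hr0 : r ≠ 0) (hr : ‖r‖ < 1) :
    HasSum (fun k : ℤ => (-1 : ℂ) ^ k * r ^ (k * (3 * k - 1) / 2)) (qPochInf r r) := by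
  have hr3 : ‖r ^ 3‖ < 1 := by
    rw [norm_pow]
    exact pow_lt_one₀ (norm_nonneg r) hr (by norm_num)
  -- Base $r^3$ and $x=-r$ make the three factors the residue classes mod 3 of $(r;r)_\infty$.
  have h := hasSum_triple (x := -r) (pow_ne_zero 3 hr0) hr3 (neg_ne_zero.mpr hr0)
  have e : qPochInf₃ (-(-r)) (-(r ^ 3 / -r)) (r ^ 3) (r ^ 3) = qPochInf r r := by
    rw [← prod_qPochInf_mul_pow r hr three_ne_zero, qPochInf₃]
    simp only [Finset.prod_range_succ, Finset.prod_range_zero, one_mul, neg_neg, pow_zero, mul_one]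
    rw [show -(r ^ 3 / -r) = r * r ^ 1 by field_simp, show r * r ^ 2 = r ^ 3 by ring]
  rw [e] at h
  convert h using 2 with k
  have e1 : k * (3 * k - 1) / 2 = 3 * (k * (k - 1) / 2) + k := by
    have h1 := two_mul_triangle k
    rw [show k * (3 * k - 1) = 2 * (3 * (k * (k - 1) / 2) + k) by linear_combination -3 * h1]
    omega
  rw [e1, zpow_add₀ hr0, zpow_mul, neg_eq_neg_one_mul r, mul_zpow]
  norm_cast
  ring

/-- The Jacobi triple product with quadratic exponents `12 k² - (12 - a) k`. -/
theorem hasSum_theta {q : ℂ} (hq0 : q ≠ 0) (hq : ‖q‖ < 1) {a b : ℕ} (hab : a + b = 24) :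
    HasSum (fun k : ℤ => q ^ (12 * k ^ 2 - (12 - a) * k))
      (qPochInf₃ (-q ^ a) (-q ^ b) (q ^ 24) (q ^ 24)) := by
  have hq24 : ‖q ^ 24‖ < 1 := by
    rw [norm_pow]
    exact pow_lt_one₀ (norm_nonneg q) hq (by norm_num)
  have h := hasSum_triple (pow_ne_zero 24 hq0) hq24 (pow_ne_zero a hq0)
  rw [show q ^ 24 / q ^ a = q ^ b by rw [← hab, pow_add]; field_simp] at h
  refine h.congr_fun fun k => ?_
  rw [← zpow_natCast, ← zpow_natCast, ← zpow_mul, ← zpow_mul, ← zpow_add₀ hq0]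
  congr 1
  push_cast
  linear_combination -12 * (two_mul_triangle k)

/-! ### Dissections of the pentagonal series -/

theorem HasSum.of_two_injective {α β γ : Type*} {f : γ → ℂ} {i : α → γ} {j : β → γ} {A B : ℂ}
    (hi : Function.Injective i) (hj : Function.Injective j)
    (hij : ∀ a b, i a ≠ j b) (hf : ∀ c, c ∉ Set.range i → c ∉ Set.range j → f c = 0)
    (hA : HasSum (f ∘ i) A) (hB : HasSum (f ∘ j) B) : HasSum f (A + B) := by
  have hd : Disjoint (Set.range i) (Set.range j) := by
    rw [Set.disjoint_left]
    rintro _ ⟨a, rfl⟩ ⟨b, hb⟩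
    exact hij a b hb.symm
  refine (hasSum_subtype_iff_of_support_subset fun c hc => ?_).mp
    (HasSum.add_disjoint hd (hi.hasSum_range_iff.mpr hA) (hj.hasSum_range_iff.mpr hB))
  by_contra h
  rw [Set.mem_union, not_or] at h
  exact hc (hf c h.1 h.2)

theorem zpow_two_mul' (p : ℂ) (k : ℤ) : p ^ (2 * k) = (p ^ 2) ^ k := by
  rw [zpow_mul, zpow_ofNat]

theorem qPochInf_sq {q : ℂ} (hq0 : q ≠ 0) (hq : ‖q‖ < 1) :
    qPochInf (q ^ 2) (q ^ 2) = qPochInf₃ (-q ^ 10) (-q ^ 14) (q ^ 24) (q ^ 24)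
      - q ^ 2 * qPochInf₃ (-q ^ 2) (-q ^ 22) (q ^ 24) (q ^ 24) := by
  have hq2 : ‖q ^ 2‖ < 1 := by
    rw [norm_pow]
    exact pow_lt_one₀ (norm_nonneg q) hq (by norm_num)
  have hA := hasSum_theta hq0 hq (a := 10) (b := 14) rfl
  have hB := (hasSum_theta hq0 hq (a := 2) (b := 22) rfl).mul_left (-q ^ 2)
  rw [sub_eq_add_neg, ← neg_mul]
  refine (hasSum_pentagonal (pow_ne_zero 2 hq0) hq2).unique
    -- Odd indices are listed as $1-2m$ so that the exponent becomes $12m^2-10m+2$, the form in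
    -- `hasSum_theta`.
    (HasSum.of_two_injective (i := fun m : ℤ => 2 * m) (j := fun m : ℤ => 1 - 2 * m)
      (fun a b h => by simpa using h) (fun a b h => by simpa using h)
      (fun a b => by omega) ?_ ?_ ?_)
  · intro c h1 h2
    rcases Int.even_or_odd' c with ⟨m, rfl | rfl⟩
    · exact (h1 ⟨m, rfl⟩).elim
    · exact (h2 ⟨-m, by simp only; ring⟩).elim
  · refine hA.congr_fun fun m => ?_
    simp only [Function.comp_apply]
    rw [show 2 * m * (3 * (2 * m) - 1) = 2 * (6 * m ^ 2 - m) by ring,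
      Int.mul_ediv_cancel_left _ two_ne_zero, (even_two_mul _).neg_one_zpow, one_mul,
      ← zpow_two_mul']
    congr 1
    push_cast
    ring
  · refine hB.congr_fun fun m => ?_
    simp only [Function.comp_apply]
    rw [show (1 - 2 * m) * (3 * (1 - 2 * m) - 1) = 2 * (6 * m ^ 2 - 5 * m + 1) by ring,
      Int.mul_ediv_cancel_left _ two_ne_zero, Odd.neg_one_zpow ⟨-m, by ring⟩, ← zpow_two_mul',
      show 2 * (6 * m ^ 2 - 5 * m + 1) = 12 * m ^ 2 - (12 - (2 : ℕ)) * m + 2 by push_cast; ring,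
      zpow_add₀ hq0, zpow_ofNat]
    ring

theorem qPochInf_mul_neg {q : ℂ} (hq : ‖q‖ < 1) :
    qPochInf q q * qPochInf (-q) q = qPochInf (q ^ 2) (q ^ 2) := by
  have hq2 : ‖q ^ 2‖ < 1 := by
    rw [norm_pow]
    exact pow_lt_one₀ (norm_nonneg q) hq (by norm_num)
  rw [qPochInf, qPochInf, qPochInf,
    ← (multipliable_qPochInf q hq).tprod_mul (multipliable_qPochInf (-q) hq)]
  exact tprod_congr fun i => by ring

/-- Used at $p$ and at $-p$, which share the factor $(p^2;p^2)_\infty$. -/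
theorem qPochInf_sq_mul {p : ℂ} (hp : ‖p‖ < 1) :
    qPochInf (p ^ 2) (p ^ 2) * qPochInf p (p ^ 2) = qPochInf p p := by
  rw [← prod_qPochInf_mul_pow p hp two_ne_zero]
  simp only [Finset.prod_range_succ, Finset.prod_range_zero, one_mul, pow_zero, mul_one, pow_one]
  rw [mul_comm, sq]

/-- Averaging over $\pm p$ keeps the even pentagonal numbers: $k(3k-1)/2$ is even exactly when
$k\equiv 0,3 \pmod 4$. -/
theorem qPochInf_add_qPochInf_neg {p : ℂ} (hp0 : p ≠ 0) (hp : ‖p‖ < 1) :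
    (qPochInf p p + qPochInf (-p) (-p)) / 2 =
      qPochInf₃ (-(p ^ 2) ^ 11) (-(p ^ 2) ^ 13) ((p ^ 2) ^ 24) ((p ^ 2) ^ 24)
      - p ^ 2 * qPochInf₃ (-(p ^ 2) ^ 5) (-(p ^ 2) ^ 19) ((p ^ 2) ^ 24) ((p ^ 2) ^ 24) := by
  have hq2 : ‖p ^ 2‖ < 1 := by
    rw [norm_pow]
    exact pow_lt_one₀ (norm_nonneg p) hp (by norm_num)
  have hq0 := pow_ne_zero 2 hp0
  have hA := hasSum_theta hq0 hq2 (a := 11) (b := 13) rfl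
  have hB := (hasSum_theta hq0 hq2 (a := 5) (b := 19) rfl).mul_left (-p ^ 2)
  have h := ((hasSum_pentagonal hp0 hp).add
    (hasSum_pentagonal (neg_ne_zero.mpr hp0) (by rwa [norm_neg]))).div_const 2
  have hval : ∀ k : ℤ, ((-1 : ℂ) ^ k * p ^ (k * (3 * k - 1) / 2) +
      (-1) ^ k * (-p) ^ (k * (3 * k - 1) / 2)) / 2 =
      (-1) ^ k * ((1 + (-1) ^ (k * (3 * k - 1) / 2)) / 2) * p ^ (k * (3 * k - 1) / 2) := by
    intro k
    rw [neg_eq_neg_one_mul p, mul_zpow]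
    ring
  simp only [hval] at h
  rw [sub_eq_add_neg, ← neg_mul]
  refine h.unique
    (HasSum.of_two_injective (i := fun m : ℤ => 4 * m) (j := fun m : ℤ => 4 * m - 1)
      (fun a b h => by simpa using h) (fun a b h => by simpa using h)
      (fun a b => by omega) ?_ ?_ ?_)
  · intro c h1 h2
    have hodd : Odd (c * (3 * c - 1) / 2) := by
      have h3 : c % 4 = 1 ∨ c % 4 = 2 := by
        have h4 : c % 4 ≠ 0 := fun h => h1 ⟨c / 4, by simp only; omega⟩
        have h5 : c % 4 ≠ 3 := fun h => h2 ⟨(c + 1) / 4, by simp only; omega⟩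
        omega
      rcases h3 with h3 | h3
      · obtain ⟨m, rfl⟩ : ∃ m, c = 4 * m + 1 := ⟨c / 4, by omega⟩
        rw [show (4 * m + 1) * (3 * (4 * m + 1) - 1) = 2 * (2 * (12 * m ^ 2 + 5 * m) + 1) by ring,
          Int.mul_ediv_cancel_left _ two_ne_zero]
        exact ⟨_, rfl⟩
      · obtain ⟨m, rfl⟩ : ∃ m, c = 4 * m + 2 := ⟨c / 4, by omega⟩
        rw [show (4 * m + 2) * (3 * (4 * m + 2) - 1) =
          2 * (2 * (12 * m ^ 2 + 11 * m + 2) + 1) by ring, Int.mul_ediv_cancel_left _ two_ne_zero]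
        exact ⟨_, rfl⟩
    rw [hodd.neg_one_zpow]
    ring
  · refine hA.congr_fun fun m => ?_
    simp only [Function.comp_apply]
    rw [show 4 * m * (3 * (4 * m) - 1) = 2 * (2 * (12 * m ^ 2 - m)) by ring,
      Int.mul_ediv_cancel_left _ two_ne_zero, (even_two_mul _).neg_one_zpow,
      Even.neg_one_zpow ⟨2 * m, by ring⟩, zpow_two_mul',
      show 12 * m ^ 2 - m = 12 * m ^ 2 - (12 - (11 : ℕ)) * m by push_cast; ring]
    ring
  · refine hB.congr_fun fun m => ?_
    simp only [Function.comp_apply]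
    rw [show (4 * m - 1) * (3 * (4 * m - 1) - 1) = 2 * (2 * (12 * m ^ 2 - 7 * m + 1)) by ring,
      Int.mul_ediv_cancel_left _ two_ne_zero, (even_two_mul _).neg_one_zpow,
      Odd.neg_one_zpow ⟨2 * m - 1, by ring⟩, zpow_two_mul', zpow_add_one₀ hq0,
      show 12 * m ^ 2 - 7 * m = 12 * m ^ 2 - (12 - (5 : ℕ)) * m by push_cast; ring]
    ring

/-! ### Even-degree parts of Euler's expansion -/

theorem hasSum_even_terms {a : ℕ → ℂ} {x S T : ℂ} (h1 : HasSum (fun k => a k * x ^ k) S)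
    (h2 : HasSum (fun k => a k * (-x) ^ k) T) :
    HasSum (fun n => a (2 * n) * x ^ (2 * n)) ((S + T) / 2) := by
  have h := (h1.add h2).div_const 2
  have hinj : Function.Injective fun n : ℕ => 2 * n := fun a b h => by simpa using h
  rw [← hinj.hasSum_iff] at h
  · refine h.congr_fun fun n => ?_
    simp only [Function.comp_apply, (even_two_mul n).neg_pow]
    ring
  · intro k hk
    have hodd : Odd k := by
      by_contra he
      obtain ⟨m, rfl⟩ := Nat.not_odd_iff_even.mp he
      exact hk ⟨m, by simp only; ring⟩
    rw [hodd.neg_pow]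
    ring

theorem choose_two_two_mul (n : ℕ) : (2 * n).choose 2 = 2 * n ^ 2 - n := by
  have h := two_mul_choose_two (2 * n)
  have h1 : n ≤ 2 * n ^ 2 := by nlinarith [Nat.zero_le n]
  zify [h1]
  push_cast at h
  linarith

/-- At $x=\pm1$ the products are $(-1;q)_\infty=2(-q;q)_\infty$ and $(1;q)_\infty=0$. -/
theorem hasSum_even_euler_one {q : ℂ} (hq : ‖q‖ < 1) :
    HasSum (fun n : ℕ => q ^ (2 * n ^ 2 - n) / qPoch q q (2 * n)) (qPochInf (-q) q) := by
  have h := hasSum_even_terms (hasSum_euler hq 1) (hasSum_euler hq (-1))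
  have h1 : qPochInf (-(-1)) q = 0 := by
    refine tprod_of_exists_eq_zero ⟨0, by simp⟩
  have h2 : qPochInf (-1) q = 2 * qPochInf (-q) q := by
    have h3 := (tendsto_qPoch (-1) hq).comp (tendsto_add_atTop_nat 1)
    refine tendsto_nhds_unique h3 (((tendsto_qPoch (-q) hq).const_mul 2).congr fun n => ?_)
    rw [Function.comp_apply, qPoch_succ', neg_one_mul]
    norm_num
  rw [h1, h2, add_zero, mul_div_cancel_left₀ _ two_ne_zero] at h
  simpa [choose_two_two_mul] using h

/-- The factor $p^{2n}=q^n$ raises the exponent $\binom{2n}{2}=2n^2-n$ to $2n^2$. -/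
theorem hasSum_even_euler_sqrt {p q : ℂ} (hpq : p ^ 2 = q) (hq : ‖q‖ < 1) :
    HasSum (fun n : ℕ => q ^ (2 * n ^ 2) / qPoch q q (2 * n))
      ((qPochInf (-p) q + qPochInf p q) / 2) := by
  have h := hasSum_even_terms (hasSum_euler hq p) (hasSum_euler hq (-p))
  rw [neg_neg] at h
  refine h.congr_fun fun n => ?_
  have h1 : n ≤ 2 * n ^ 2 := by nlinarith [Nat.zero_le n]
  rw [choose_two_two_mul, pow_mul p, hpq, div_mul_eq_mul_div, ← pow_add, Nat.sub_add_cancel h1]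

theorem hasSum_evenDegree_sub {p q : ℂ} (hpq : p ^ 2 = q) (hq : ‖q‖ < 1) :
    HasSum (fun n : ℕ+ =>
      q ^ (2 * (n : ℕ) ^ 2 - (n : ℕ)) / ((1 + q ^ (n : ℕ)) * qPoch q q (2 * (n : ℕ) - 1)))
      (qPochInf (-q) q - (qPochInf (-p) q + qPochInf p q) / 2) := by
  have h := (hasSum_even_euler_one hq).sub (hasSum_even_euler_sqrt hpq hq)
  -- The $n=0$ terms of the two series are both 1 and cancel, so the sum runs over positive $n$.
  rw [← PNat.coe_injective.hasSum_iff] at h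
  · refine h.congr_fun fun n => ?_
    obtain ⟨m, hm⟩ : ∃ m, (n : ℕ) = m + 1 := ⟨n - 1, by have := n.pos; omega⟩
    have h1 : (n : ℕ) ≤ 2 * (n : ℕ) ^ 2 := by nlinarith [n.pos]
    have h2 : q ^ (2 * (n : ℕ) ^ 2) = q ^ (2 * (n : ℕ) ^ 2 - (n : ℕ)) * q ^ (n : ℕ) := by
      rw [← pow_add, Nat.sub_add_cancel h1]
    have h3 : qPoch q q (2 * n) = qPoch q q (2 * n - 1) * ((1 - q ^ (n : ℕ)) * (1 + q ^ (n : ℕ))) := by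
      rw [hm, show 2 * (m + 1) - 1 = 2 * m + 1 by omega,
        show 2 * (m + 1) = 2 * m + 1 + 1 by ring, qPoch_succ]
      ring
    have h4 := qPoch_self_ne_zero hq (2 * n)
    rw [h3] at h4
    simp only [mul_ne_zero_iff] at h4
    obtain ⟨h5, h6, h7⟩ := h4
    simp only [Function.comp_apply]
    rw [h2, h3]
    field_simp
  · intro k hk
    obtain rfl : k = 0 := by
      by_contra hne
      exact hk ⟨⟨k, Nat.pos_of_ne_zero hne⟩, rfl⟩
    simp

/-! ### The identity -/

theorem mainTheorem4 (q : ℂ) (hq0 : 0 < ‖q‖) (hq1 : ‖q‖ < 1) :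
    Summable (fun n : ℕ+ =>
      q ^ (2 * (n : ℕ) ^ 2 - (n : ℕ)) / ((1 + q ^ (n : ℕ)) * qPoch q q (2 * (n : ℕ) - 1))) ∧
    qPochInf q q * ∑' n : ℕ+,
        q ^ (2 * (n : ℕ) ^ 2 - (n : ℕ)) / ((1 + q ^ (n : ℕ)) * qPoch q q (2 * (n : ℕ) - 1))
      = qPochInf₃ (-q ^ 10) (-q ^ 14) (q ^ 24) (q ^ 24)
        - qPochInf₃ (-q ^ 11) (-q ^ 13) (q ^ 24) (q ^ 24)
        + q * qPochInf₃ (-q ^ 5) (-q ^ 19) (q ^ 24) (q ^ 24)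
        - q ^ 2 * qPochInf₃ (-q ^ 2) (-q ^ 22) (q ^ 24) (q ^ 24) := by
  have hq := norm_pos_iff.mp hq0
  -- Either square root serves, since $p$ enters only through expressions invariant under $p\mapsto
  -- -p$.
  obtain ⟨p, hp⟩ : ∃ p : ℂ, p ^ 2 = q := IsAlgClosed.exists_pow_nat_eq q two_pos
  have h := hasSum_evenDegree_sub hp hq1
  refine ⟨h.summable, ?_⟩
  rw [h.tsum_eq, mul_sub, qPochInf_mul_neg hq1, qPochInf_sq hq hq1]
  subst hp
  have hp0 : p ≠ 0 := fun h => hq (by simp [h])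
  have hp1 : ‖p‖ < 1 := by
    rw [norm_pow] at hq1
    exact (sq_lt_one_iff₀ (norm_nonneg p)).mp hq1
  have e1 := qPochInf_sq_mul hp1
  have e2 := qPochInf_sq_mul (p := -p) (by rwa [norm_neg])
  rw [neg_sq] at e2
  have e3 := qPochInf_add_qPochInf_neg hp0 hp1
  rw [← e1, ← e2] at e3
  linear_combination -e3
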